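/- For integers $\ell\ge 0$ and $N\ge 0$ let \[ \zeta^{\ast}_{N}(\{1\}_{\ell})=\sum_{N\ge n_1\ge n_2\ge\cdots\ge n_\ell\ge 1}\frac{1}{n_1n_2\cdots n_\ell}, \qquad \zeta^{\ast}_{N}(\{1\}_{0})=1, \] and for integers $\ell_1, r_1, r_2\ge 0$ with $r_1+r_2\ge 2$ consider the series \[ S(\ell_1,0,r_1,r_2)=\sum_{n\ge 1}\frac{\zeta^{\ast}_{n-1}(\{1\}_{\ell_1})}{\binom{n+r_1}{r_1}\,n^{r_2}} . \] (i) For all integers $\ell_1\ge 0$ and $r_1\ge 1$, the series $S(\ell_1,0,r_1,1)$ converges and its value is a polynomial with rational coefficients in the zeta values $\zeta(i)$, $i\ge 2$. (ii) For all integers $0\le \ell_1\le 2$ and $r_1\ge 0$, the series $S(\ell_1,0,r_1,2)$ converges and its value is a polynomial with rational coefficients in the zeta values $\zeta(i)$, $i\ge 2$. -/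

import Mathlib

/-- The truncated multiple zeta value
`∑_{N ≥ n₁ > n₂ > ⋯ > n_k ≥ 1} 1 / (n₁ ^ i₁ ⋯ n_k ^ i_k)` for the list of exponents
`[i₁, …, i_k]`, as an iterated sum over `n₁`, then `n₂ ≤ n₁ - 1`, and so on. It is `1` for the
empty list. -/
noncomputable def truncMZV : List ℕ → ℕ → ℝ
  | [], _ => 1
  | i :: is, N => ∑ n ∈ Finset.Icc 1 N, 1 / (n : ℝ) ^ i * truncMZV is (n - 1)

/-- The truncated multiple zeta star value
`∑_{N ≥ n₁ ≥ n₂ ≥ ⋯ ≥ n_k ≥ 1} 1 / (n₁ ^ i₁ ⋯ n_k ^ i_k)` for the list of exponents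
`[i₁, …, i_k]`, as an iterated sum over `n₁`, then `n₂ ≤ n₁`, and so on. It is `1` for the
empty list. -/
noncomputable def truncMZSV : List ℕ → ℕ → ℝ
  | [], _ => 1
  | i :: is, N => ∑ n ∈ Finset.Icc 1 N, 1 / (n : ℝ) ^ i * truncMZSV is n

/-- The `n`-th summand (`n ≥ 1`) of the series `S(ℓ₁, ℓ₂, r₁, r₂)`. -/
noncomputable def seriesTerm (l₁ l₂ r₁ r₂ n : ℕ) : ℝ :=
  truncMZSV (List.replicate l₁ 1) (n - 1) * truncMZV (List.replicate l₂ 1) (n - 1) /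
    (((n + r₁).choose r₁ : ℝ) * (n : ℝ) ^ r₂)

/-- The series `S(ℓ₁, ℓ₂, r₁, r₂)`, the sum of its summands over all `n ≥ 1`. -/
noncomputable def seriesS (l₁ l₂ r₁ r₂ : ℕ) : ℝ :=
  ∑' n : ℕ, seriesTerm l₁ l₂ r₁ r₂ (n + 1)

/-- `x` is a polynomial with rational coefficients in the zeta values `ζ(2), ζ(3), ζ(4), …`. -/
def IsRatPolyInZetas (x : ℝ) : Prop :=
  ∃ p : MvPolynomial {i : ℕ // 2 ≤ i} ℚ,
    (x : ℂ) = MvPolynomial.aeval (fun i : {i : ℕ // 2 ≤ i} => riemannZeta ((i : ℕ) : ℂ)) p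

/-!
The series are evaluated by elementary means, from three ingredients.

*The values `ζ*(2, {1}_l)`.* The generating function of the star values is
`∑_l ζ*ₙ({1}_l) t ^ l = n! / (1 - t)ₙ`. It is the value at `k = 0` of the connector
`C(n, k) = n! (1 - t)ₖ / (1 - t)ₙ₊ₖ`, which satisfies
`(k - t) C(n, k) = n (C(n - 1, k) - C(n, k))` and `n C(n, k) = (k - t) (C(n, k - 1) - C(n, k))`.
Telescoping with the first relation gives `∑ₙ C(n, k) / n = 1 / (k - t)`; with the second one,
`∑ₙ C(n, 0) / n ^ 2 = ∑_{k ≥ 1} 1 / (k - t) ^ 2`, so that `ζ*(2, {1}_l) = (l + 1) ζ(l + 2)`. The proofs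
work with the coefficients `conn l k n` of `t ^ l` in `C(n, k)`, which are nonnegative
(`hasSum_conn_succ_div`, `hasSum_connSum_two`).

*Series with one factor `1 / n`.* The function `1 / (n C(n + r, r))`, an iterated difference of
`1 / n`, is for `r ≥ 1` a rational combination of the functions `1 / n - 1 / (n + j)`. Against such a
function, summation by parts lowers the depth `l` of the star value, and the recursion ends in rational
numbers and the values `ζ*(2, {1}_l)` (`shiftedStar_mul_recip_sub_mem`).

*Series with the factor `1 / n ^ 2`.* The identity
`1 / (n ^ 2 C(n + r, r)) - 1 / (n ^ 2 C(n + r + 1, r + 1)) = 1 / ((r + 1) n C(n + r + 1, r + 1))`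
reduces them to `r = 0`. For `l ≤ 2`, passing from `ζ*ₙ₋₁` to `ζ*ₙ` leaves, besides values already
known, only Euler's sum `∑ₙ Hₙ / n ^ 3`, which the connector expresses through `ζ(2, 2)`, `ζ(4)`
and itself (`connSum_three_mem`).
-/

open Filter Topology Finset

namespace ZetaStar

/-! ### Convergence and summation by parts -/

theorem hasSum_telescope {f : ℕ → ℝ} (hs : Summable fun n => f n - f (n + 1))
    (hf : Tendsto f atTop (𝓝 0)) : HasSum (fun n => f n - f (n + 1)) (f 0) := by
  have h1 := hs.hasSum.tendsto_sum_nat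
  have h2 : Tendsto (fun N => ∑ n ∈ range N, (f n - f (n + 1))) atTop (𝓝 (f 0)) := by
    simp only [sum_range_sub']
    simpa using tendsto_const_nhds.sub hf
  rw [← tendsto_nhds_unique h1 h2]
  exact hs.hasSum

/-- Summation by parts for an increasing sequence against a decreasing one. -/
theorem hasSum_abel_iff {A b : ℕ → ℝ} {x : ℝ} (hA : Monotone A) (hA0 : 0 ≤ A 0)
    (hb : Antitone b) (hb0 : ∀ n, 0 ≤ b n)
    (hlim : Tendsto (fun n => A n * b n) atTop (𝓝 0)) :
    HasSum (fun n => (A (n + 1) - A n) * b n) x ↔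
      HasSum (fun n => A (n + 1) * (b n - b (n + 1))) (x + A 0 * b 0) := by
  rw [hasSum_iff_tendsto_nat_of_nonneg
      (fun n => mul_nonneg (sub_nonneg.2 (hA n.le_succ)) (hb0 n)),
    hasSum_iff_tendsto_nat_of_nonneg
      (fun n => mul_nonneg (hA0.trans (hA (Nat.zero_le _))) (sub_nonneg.2 (hb n.le_succ)))]
  have key : ∀ N, ∑ n ∈ range N, A (n + 1) * (b n - b (n + 1))
      = ∑ n ∈ range N, (A (n + 1) - A n) * b n + A 0 * b 0 - A N * b N := by
    intro N
    induction N with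
    | zero => simp
    | succ N ih => rw [sum_range_succ, sum_range_succ, ih]; ring
  simp only [key]
  refine ⟨fun h => by simpa using (h.add_const (A 0 * b 0)).sub hlim, fun h => ?_⟩
  simpa using (h.add hlim).sub_const (A 0 * b 0)

theorem hasSum_of_eq {f g : ℕ → ℝ} {x : ℝ} (h : ∀ n, f n = g n) (hg : HasSum g x) :
    HasSum f x :=
  (funext h : f = g) ▸ hg

/-! ### Shifted star sums and the connector -/

/-- The complete homogeneous symmetric polynomial of degree `l` in
`1 / (k + 1), …, 1 / (k + n)`; for `k = 0` this is the truncated star value `ζ*ₙ({1}_l)`. -/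
noncomputable def shiftedStar : ℕ → ℕ → ℕ → ℝ
  | 0, _, _ => 1
  | l + 1, k, n => ∑ i ∈ range n, shiftedStar l k (i + 1) / (k + i + 1)

@[simp] theorem shiftedStar_zero_left (k n : ℕ) : shiftedStar 0 k n = 1 := rfl

@[simp] theorem shiftedStar_succ_zero (l k : ℕ) : shiftedStar (l + 1) k 0 = 0 := by
  simp [shiftedStar]

theorem shiftedStar_succ_succ (l k n : ℕ) :
    shiftedStar (l + 1) k (n + 1)
      = shiftedStar (l + 1) k n + shiftedStar l k (n + 1) / (k + n + 1) := by
  simp [shiftedStar, sum_range_succ]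

theorem shiftedStar_nonneg (l k n : ℕ) : 0 ≤ shiftedStar l k n := by
  induction l generalizing n with
  | zero => simp
  | succ l ih => exact sum_nonneg fun i _ => div_nonneg (ih _) (by positivity)

theorem shiftedStar_le (l k n : ℕ) : shiftedStar l k n ≤ shiftedStar l 0 n := by
  induction l generalizing n with
  | zero => simp
  | succ l ih =>
    refine sum_le_sum fun i _ => ?_
    gcongr
    · exact shiftedStar_nonneg _ _ _
    · exact ih _
    · positivity

theorem monotone_shiftedStar (l k : ℕ) : Monotone (shiftedStar l k) := by
  refine monotone_nat_of_le_succ fun n => ?_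
  cases l with
  | zero => simp
  | succ l =>
    rw [shiftedStar_succ_succ]
    exact le_add_of_nonneg_right (div_nonneg (shiftedStar_nonneg _ _ _) (by positivity))

theorem truncMZSV_eq_shiftedStar (l n : ℕ) :
    truncMZSV (List.replicate l 1) n = shiftedStar l 0 n := by
  induction l generalizing n with
  | zero => simp [truncMZSV]
  | succ l ih =>
    induction n with
    | zero => simp [truncMZSV, List.replicate_succ]
    | succ n ihn =>
      rw [List.replicate_succ, truncMZSV] at *
      rw [sum_Icc_succ_top (by omega), ihn, shiftedStar_succ_succ, ih]
      push_cast
      ring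

/-- A crude growth bound for the star values (they grow like `(log n) ^ l`), enough for all
convergence questions below. -/
theorem shiftedStar_zero_le_sqrt (l n : ℕ) :
    shiftedStar l 0 (n + 1) ≤ 2 ^ l * √(n + 1) := by
  induction l generalizing n with
  | zero => simp
  | succ l ih =>
    induction n with
    | zero =>
      have := ih 0
      simp only [shiftedStar_succ_succ, shiftedStar_succ_zero] at *
      simp at *
      have : (2 : ℝ) ^ l ≤ 2 ^ (l + 1) := by gcongr <;> norm_num
      linarith
    | succ n ihn =>
      rw [shiftedStar_succ_succ]
      set a := √((n : ℝ) + 1)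
      have hc := ih (n + 1)
      push_cast at hc ⊢
      set b := √((n : ℝ) + 1 + 1)
      have hb : 0 < b := by positivity
      have hb2 : b ^ 2 = (n : ℝ) + 1 + 1 := Real.sq_sqrt (by positivity)
      have ha2 : a ^ 2 = (n : ℝ) + 1 := Real.sq_sqrt (by positivity)
      have h1 : shiftedStar l 0 (n + 1 + 1) / (0 + ((n : ℝ) + 1) + 1) ≤ 2 ^ l / b := by
        rw [zero_add, ← hb2, div_le_div_iff₀ (by positivity) hb]
        nlinarith
      -- the increment of `2 √x` over a unit step dominates `1 / √x` at the right end
      have h2 : 1 / b ≤ 2 * (b - a) := by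
        rw [div_le_iff₀ hb]
        nlinarith [sq_nonneg (b - a)]
      have h3 : (2 : ℝ) ^ l / b ≤ 2 ^ l * (2 * (b - a)) := by
        rw [div_eq_mul_one_div]; gcongr
      rw [pow_succ] at *
      linarith

/-- The coefficient of `t ^ l` in `n! (1 - t)ₖ / (1 - t)ₙ₊ₖ`. -/
noncomputable def conn (l k n : ℕ) : ℝ := shiftedStar l k n / ((n + k).choose k : ℝ)

@[simp] theorem conn_zero_shift (l n : ℕ) : conn l 0 n = shiftedStar l 0 n := by
  simp [conn]

theorem conn_nonneg (l k n : ℕ) : 0 ≤ conn l k n :=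
  div_nonneg (shiftedStar_nonneg _ _ _) (by positivity)

theorem choose_pos_real (n k : ℕ) : (0 : ℝ) < ((n + k).choose k : ℝ) := by
  exact_mod_cast Nat.choose_pos (by omega)

theorem choose_succ_left (n k : ℕ) :
    ((n + 1 + k).choose k : ℝ) * (n + 1) = ((n + k).choose k : ℝ) * (n + k + 1) := by
  have := Nat.choose_mul_succ_eq (n + k) k
  rw [show n + k + 1 - k = n + 1 by omega, show n + k + 1 = n + 1 + k by omega] at this
  have h : (((n + k).choose k * (n + 1 + k) : ℕ) : ℝ) = ((n + 1 + k).choose k * (n + 1) : ℕ) := by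
    rw [this]
  push_cast at h
  linarith

theorem choose_succ_right (n k : ℕ) :
    ((n + (k + 1)).choose (k + 1) : ℝ) * (k + 1) = ((n + k).choose k : ℝ) * (n + k + 1) := by
  have := Nat.add_one_mul_choose_eq (n + k) k
  have h : (((n + k + 1) * (n + k).choose k : ℕ) : ℝ)
      = ((n + k + 1).choose (k + 1) * (k + 1) : ℕ) := by rw [this]
  push_cast at h
  rw [← add_assoc]
  linarith

theorem conn_le_div_shift (l k n : ℕ) :
    conn l k (n + 1) ≤ shiftedStar l 0 (n + 1) / (k + 1) := by
  refine div_le_div₀ (shiftedStar_nonneg _ _ _) (shiftedStar_le _ _ _) (by positivity) ?_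
  have : k + 1 ≤ (n + 1 + k).choose k := by
    calc k + 1 = (k + 1).choose k := by simp
      _ ≤ _ := Nat.choose_le_choose k (by omega)
  exact_mod_cast this

theorem conn_succ_le_div (l k n : ℕ) :
    conn l (k + 1) n ≤ shiftedStar l 0 n / (n + 1) := by
  refine div_le_div₀ (shiftedStar_nonneg _ _ _) (shiftedStar_le _ _ _) (by positivity) ?_
  have : n + 1 ≤ (n + (k + 1)).choose (k + 1) := by
    rw [← Nat.choose_symm_add]
    calc n + 1 = (n + 1).choose n := by simp
      _ ≤ _ := Nat.choose_le_choose n (by omega)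
  exact_mod_cast this

theorem conn_le (l k n : ℕ) : conn l k (n + 1) ≤ shiftedStar l 0 (n + 1) :=
  (conn_le_div_shift l k n).trans
    (div_le_self (shiftedStar_nonneg _ _ _) (by simp))

theorem conn_zero_step (k n : ℕ) :
    k * (conn 0 k (n + 1) / (n + 1)) = conn 0 k n - conn 0 k (n + 1) := by
  have h := choose_succ_left n k
  have h1 := choose_pos_real n k
  have h2 := choose_pos_real (n + 1) k
  simp only [conn, shiftedStar_zero_left]
  field_simp
  linear_combination -h

/-- Comparison of coefficients in `(k - t) C(n + 1, k) = (n + 1) (C(n, k) - C(n + 1, k))`, where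
`C(n, k) = n! (1 - t)ₖ / (1 - t)ₙ₊ₖ`. -/
theorem conn_succ_step (l k n : ℕ) :
    k * (conn (l + 1) k (n + 1) / (n + 1)) =
      conn l k (n + 1) / (n + 1) + (conn (l + 1) k n - conn (l + 1) k (n + 1)) := by
  have h := choose_succ_left n k
  have h1 := choose_pos_real n k
  have h2 := choose_pos_real (n + 1) k
  have h3 : ((n + 1 + k).choose k : ℝ) = ((n + k).choose k : ℝ) * (n + k + 1) / (n + 1) := by
    field_simp; linear_combination h
  simp only [conn, shiftedStar_succ_succ, h3]
  field_simp
  ring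

theorem shiftedStar_one_shift (k n : ℕ) :
    shiftedStar 1 k n - 1 / (k + 1) = shiftedStar 1 (k + 1) n - 1 / (n + k + 1) := by
  induction n with
  | zero => simp
  | succ n ih =>
    rw [shiftedStar_succ_succ, shiftedStar_succ_succ]
    push_cast
    simp only [shiftedStar_zero_left]
    have e : (1 : ℝ) / (k + n + 1) = 1 / (n + k + 1) := by ring_nf
    have e' : (1 : ℝ) / (k + 1 + n + 1) = 1 / (n + 1 + k + 1) := by ring_nf
    rw [e, e']
    linarith

/-- Comparison of coefficients in
`(1 - t/(k+1)) ∏ᵢ (1 - t/(k+i))⁻¹ = (1 - t/(n+k+1)) ∏ᵢ (1 - t/(k+1+i))⁻¹`. -/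
theorem shiftedStar_shift (l k n : ℕ) :
    shiftedStar (l + 1) k n - shiftedStar l k n / (k + 1)
      = shiftedStar (l + 1) (k + 1) n - shiftedStar l (k + 1) n / (n + k + 1) := by
  induction l generalizing n with
  | zero => simpa using shiftedStar_one_shift k n
  | succ l ihl =>
    induction n with
    | zero => simp
    | succ n ihn =>
      have h := ihl (n + 1)
      rw [shiftedStar_succ_succ (l + 1), shiftedStar_succ_succ (l + 1)]
      have e1 := shiftedStar_succ_succ l k n
      have e2 := shiftedStar_succ_succ l (k + 1) n
      push_cast at *
      have p1 : (k : ℝ) + 1 ≠ 0 := by positivity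
      have p2 : (n : ℝ) + k + 1 ≠ 0 := by positivity
      have p3 : (n : ℝ) + 1 + k + 1 ≠ 0 := by positivity
      rw [show (k : ℝ) + n + 1 = n + k + 1 by ring] at *
      rw [show (k : ℝ) + 1 + n + 1 = n + 1 + k + 1 by ring] at *
      linear_combination ihn + h / ((n : ℝ) + k + 1) - e1 / (k + 1) + e2 / ((n : ℝ) + k + 1)

theorem conn_zero_shift_step (k n : ℕ) :
    (k + 1) * (conn 0 k n - conn 0 (k + 1) n) = n * conn 0 (k + 1) n := by
  have h := choose_succ_right n k
  have h1 := choose_pos_real n k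
  have h2 := choose_pos_real n (k + 1)
  simp only [conn, shiftedStar_zero_left]
  field_simp
  linear_combination h

/-- Comparison of coefficients in `(k + 1 - t) (C(n, k) - C(n, k + 1)) = n C(n, k + 1)`, where
`C(n, k) = n! (1 - t)ₖ / (1 - t)ₙ₊ₖ`. -/
theorem conn_succ_shift_step (l k n : ℕ) :
    (k + 1) * (conn (l + 1) k n - conn (l + 1) (k + 1) n) =
      (conn l k n - conn l (k + 1) n) + n * conn (l + 1) (k + 1) n := by
  have h := choose_succ_right n k
  have h1 := choose_pos_real n k
  have h2 := choose_pos_real n (k + 1)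
  have h3 : ((n + (k + 1)).choose (k + 1) : ℝ)
      = ((n + k).choose k : ℝ) * (n + k + 1) / (k + 1) := by
    field_simp; linear_combination h
  have h4 := shiftedStar_shift l k n
  simp only [conn, h3]
  field_simp at h4 ⊢
  linear_combination h4

/-! ### Connected sums -/

theorem summable_shiftedStar_div_pow (l : ℕ) {p : ℕ} (hp : 2 ≤ p) :
    Summable fun n : ℕ => shiftedStar l 0 (n + 1) / ((n : ℝ) + 1) ^ p := by
  have h1 : Summable fun n : ℕ => 2 ^ l * (1 / ((n : ℝ) + 1) ^ (3 / 2 : ℝ)) := by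
    have := (summable_nat_add_iff 1).2
      (Real.summable_one_div_nat_rpow.2 (by norm_num : (1 : ℝ) < 3 / 2))
    push_cast at this
    exact this.mul_left _
  refine h1.of_nonneg_of_le (fun n => div_nonneg (shiftedStar_nonneg _ _ _) (by positivity))
    fun n => ?_
  have hx : (0 : ℝ) < (n : ℝ) + 1 := by positivity
  have h2 : ((n : ℝ) + 1) ^ 2 ≤ ((n : ℝ) + 1) ^ p :=
    pow_le_pow_right₀ (by linarith [n.cast_nonneg (α := ℝ)]) hp
  have h3 : ((n : ℝ) + 1) ^ (3 / 2 : ℝ) * √((n : ℝ) + 1) = ((n : ℝ) + 1) ^ 2 := by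
    rw [Real.sqrt_eq_rpow, ← Real.rpow_add hx, ← Real.rpow_natCast]
    norm_num
  calc _ ≤ 2 ^ l * √((n : ℝ) + 1) / ((n : ℝ) + 1) ^ 2 :=
        div_le_div₀ (by positivity) (shiftedStar_zero_le_sqrt l n) (by positivity) h2
    _ = _ := by
        rw [← h3]
        field_simp

theorem summable_conn_div_pow (l k : ℕ) {p : ℕ} (hp : 2 ≤ p) :
    Summable fun n : ℕ => conn l k (n + 1) / ((n : ℝ) + 1) ^ p :=
  (summable_shiftedStar_div_pow l hp).of_nonneg_of_le
    (fun n => div_nonneg (conn_nonneg _ _ _) (by positivity)) fun n => by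
      gcongr; exact conn_le _ _ _

theorem summable_conn_succ_div (l k : ℕ) :
    Summable fun n : ℕ => conn l (k + 1) (n + 1) / ((n : ℝ) + 1) := by
  refine (summable_shiftedStar_div_pow l le_rfl).of_nonneg_of_le
    (fun n => div_nonneg (conn_nonneg _ _ _) (by positivity)) fun n => ?_
  rw [pow_two, ← div_div]
  gcongr
  refine (conn_succ_le_div l k (n + 1)).trans ?_
  refine div_le_div_of_nonneg_left (shiftedStar_nonneg _ _ _) (by positivity) ?_
  push_cast
  linarith

theorem tendsto_shiftedStar_div_atTop (l : ℕ) :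
    Tendsto (fun n : ℕ => shiftedStar l 0 n / ((n : ℝ) + 1)) atTop (𝓝 0) := by
  rw [← tendsto_add_atTop_iff_nat 1]
  have h1 : Tendsto (fun n : ℕ => (2 : ℝ) ^ l * (1 / √((n : ℝ) + 1))) atTop (𝓝 0) := by
    have : Tendsto (fun n : ℕ => √((n : ℝ) + 1)) atTop atTop :=
      Real.tendsto_sqrt_atTop.comp
        (tendsto_atTop_add_const_right _ _ tendsto_natCast_atTop_atTop)
    simpa using (this.inv_tendsto_atTop).const_mul ((2 : ℝ) ^ l)
  refine squeeze_zero (fun n => div_nonneg (shiftedStar_nonneg _ _ _) (by positivity))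
    (fun n => ?_) h1
  have hx : (0 : ℝ) < √((n : ℝ) + 1) := by positivity
  calc _ ≤ 2 ^ l * √((n : ℝ) + 1) / ((n : ℝ) + 1) := by
        refine div_le_div₀ (by positivity) (shiftedStar_zero_le_sqrt l n) (by positivity) ?_
        push_cast; linarith
    _ = 2 ^ l * √((n : ℝ) + 1) / (√((n : ℝ) + 1) * √((n : ℝ) + 1)) := by
        rw [Real.mul_self_sqrt (by positivity)]
    _ = _ := by field_simp

theorem tendsto_conn_succ (l k : ℕ) : Tendsto (conn l (k + 1)) atTop (𝓝 0) :=
  squeeze_zero (conn_nonneg _ _) (conn_succ_le_div l k) (tendsto_shiftedStar_div_atTop l)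

/-- Summing the connector over `n` against `1 / n` transports the sum to the index `k`. With `k + 1`
for `k`, this is
the coefficient of `t ^ l` in `∑ₙ n! (1 - t)ₖ / (n (1 - t)ₙ₊ₖ) = 1 / (k - t)`. -/
theorem hasSum_conn_succ_div (l k : ℕ) :
    HasSum (fun n : ℕ => conn l (k + 1) (n + 1) / ((n : ℝ) + 1)) (1 / ((k : ℝ) + 1) ^ (l + 1)) := by
  have hk : (k : ℝ) + 1 ≠ 0 := by positivity
  have hs := summable_conn_succ_div
  induction l with
  | zero =>
    have h1 : ∀ n, conn 0 (k + 1) n - conn 0 (k + 1) (n + 1)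
        = ((k : ℝ) + 1) * (conn 0 (k + 1) (n + 1) / (n + 1)) := fun n => by
      have := conn_zero_step (k + 1) n
      push_cast at this
      exact this.symm
    have h2 := hasSum_telescope (f := conn 0 (k + 1))
      (by simpa only [h1] using (hs 0 k).mul_left _) (tendsto_conn_succ 0 k)
    simp only [h1] at h2
    have h3 := h2.mul_left (((k : ℝ) + 1)⁻¹)
    simpa [conn, hk] using h3
  | succ l ih =>
    have h1 : ∀ n, conn (l + 1) (k + 1) n - conn (l + 1) (k + 1) (n + 1)
        = ((k : ℝ) + 1) * (conn (l + 1) (k + 1) (n + 1) / (n + 1))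
          - conn l (k + 1) (n + 1) / (n + 1) := fun n => by
      have := conn_succ_step l (k + 1) n
      push_cast at this
      linarith
    have h2 := hasSum_telescope (f := conn (l + 1) (k + 1))
      (by simpa only [h1] using ((hs (l + 1) k).mul_left _).sub (hs l k))
      (tendsto_conn_succ (l + 1) k)
    simp only [h1] at h2
    have h3 := (h2.add ih).mul_left (((k : ℝ) + 1)⁻¹)
    have h0 : conn (l + 1) (k + 1) 0 = 0 := by simp [conn]
    rw [h0, zero_add] at h3
    have e : 1 / ((k : ℝ) + 1) ^ (l + 1 + 1) = ((k : ℝ) + 1)⁻¹ * (1 / ((k : ℝ) + 1) ^ (l + 1)) := by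
      field_simp
      ring
    rw [e]
    refine hasSum_of_eq (fun n => ?_) h3
    rw [sub_add_cancel, inv_mul_cancel_left₀ hk]

/-- The connected sum `∑ₙ conn l k n / n ^ p` over `n ≥ 1`. -/
noncomputable def connSum (p l k : ℕ) : ℝ :=
  ∑' n : ℕ, conn l k (n + 1) / ((n : ℝ) + 1) ^ p

theorem hasSum_connSum {p : ℕ} (hp : 2 ≤ p) (l k : ℕ) :
    HasSum (fun n : ℕ => conn l k (n + 1) / ((n : ℝ) + 1) ^ p) (connSum p l k) :=
  (summable_conn_div_pow l k hp).hasSum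

theorem connSum_one_succ (l k : ℕ) : connSum 1 l (k + 1) = 1 / ((k : ℝ) + 1) ^ (l + 1) := by
  simpa [connSum] using (hasSum_conn_succ_div l k).tsum_eq

theorem connSum_nonneg (p l k : ℕ) : 0 ≤ connSum p l k :=
  tsum_nonneg fun n => div_nonneg (conn_nonneg _ _ _) (by positivity)

theorem connSum_le {p : ℕ} (hp : 2 ≤ p) (l k : ℕ) :
    connSum p l k ≤ connSum p l 0 / (k + 1) := by
  refine hasSum_le (fun n => ?_) (hasSum_connSum hp l k)
    ((hasSum_connSum hp l 0).div_const ((k : ℝ) + 1))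
  rw [div_right_comm]
  gcongr
  simpa using conn_le_div_shift l k n

theorem tendsto_connSum {p : ℕ} (hp : 2 ≤ p) (l : ℕ) :
    Tendsto (connSum p l) atTop (𝓝 0) := by
  refine squeeze_zero (connSum_nonneg p l) (connSum_le hp l) ?_
  simpa [div_eq_mul_inv] using
    (tendsto_one_div_add_atTop_nhds_zero_nat (𝕜 := ℝ)).const_mul (connSum p l 0)

theorem hasSum_connSum_succ {p : ℕ} (hp : 1 ≤ p) (l k : ℕ) :
    HasSum (fun n : ℕ => conn l (k + 1) (n + 1) / ((n : ℝ) + 1) ^ p) (connSum p l (k + 1)) := by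
  obtain rfl | hp := hp.eq_or_lt
  · simpa [connSum] using (summable_conn_succ_div l k).hasSum
  · exact hasSum_connSum hp l (k + 1)

theorem connSum_zero_sub {p : ℕ} (hp : 1 ≤ p) (k : ℕ) :
    (k + 1) * (connSum (p + 1) 0 k - connSum (p + 1) 0 (k + 1)) = connSum p 0 (k + 1) := by
  have h := hasSum_connSum (p := p + 1) (by omega)
  refine HasSum.unique (((h 0 k).sub (h 0 (k + 1))).mul_left ((k : ℝ) + 1))
    (hasSum_of_eq (fun n => ?_) (hasSum_connSum_succ hp 0 k))
  have := conn_zero_shift_step k (n + 1)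
  push_cast at this
  rw [← sub_div, ← mul_div_assoc, this]
  field_simp
  ring

theorem connSum_succ_sub {p : ℕ} (hp : 1 ≤ p) (l k : ℕ) :
    (k + 1) * (connSum (p + 1) (l + 1) k - connSum (p + 1) (l + 1) (k + 1))
      = (connSum (p + 1) l k - connSum (p + 1) l (k + 1)) + connSum p (l + 1) (k + 1) := by
  have h := hasSum_connSum (p := p + 1) (by omega)
  refine HasSum.unique (((h (l + 1) k).sub (h (l + 1) (k + 1))).mul_left ((k : ℝ) + 1))
    (hasSum_of_eq (fun n => ?_)
      (((h l k).sub (h l (k + 1))).add (hasSum_connSum_succ hp (l + 1) k)))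
  have := conn_succ_shift_step l k (n + 1)
  push_cast at this
  rw [← sub_div, ← mul_div_assoc, this]
  field_simp
  ring

/-- The coefficient of `t ^ l` in `1 / (k + 1 - t) ^ 2`. -/
theorem connSum_two_sub (l k : ℕ) :
    connSum 2 l k - connSum 2 l (k + 1) = (l + 1) / ((k : ℝ) + 1) ^ (l + 2) := by
  have hk : (k : ℝ) + 1 ≠ 0 := by positivity
  induction l with
  | zero =>
    have := connSum_zero_sub le_rfl k
    rw [connSum_one_succ] at this
    rw [← mul_right_inj' hk, this]
    field_simp
    push_cast
    ring
  | succ l ih =>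
    have := connSum_succ_sub le_rfl l k
    rw [connSum_one_succ, ih] at this
    rw [← mul_right_inj' hk, this]
    push_cast
    field_simp
    ring

theorem summable_zeta {i : ℕ} (hi : 2 ≤ i) : Summable fun n : ℕ => 1 / ((n : ℝ) + 1) ^ i := by
  simpa using summable_shiftedStar_div_pow 0 hi

/-- `connSum 2 l k = (l + 1) ∑_{j > k} 1 / j ^ (l + 2)`; at `k = 0` this evaluates `ζ*(2, {1}_l)` as
`(l + 1) ζ(l + 2)`. -/
theorem hasSum_connSum_two (l : ℕ) :
    HasSum (fun k : ℕ => (l + 1) * (1 / ((k : ℝ) + 1) ^ (l + 2))) (connSum 2 l 0) := by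
  have e : ∀ k, connSum 2 l k - connSum 2 l (k + 1) = (l + 1) * (1 / ((k : ℝ) + 1) ^ (l + 2)) :=
    fun k => by rw [connSum_two_sub]; ring
  have := hasSum_telescope (f := connSum 2 l)
    (by simpa only [e] using (summable_zeta (by omega)).mul_left _) (tendsto_connSum le_rfl l)
  simpa only [e] using this

/-! ### The algebra of zeta values -/

/-- The real numbers that are rational polynomials in `ζ(2), ζ(3), …`, as the preimage under `ℝ → ℂ` of
the algebra generated by the complex values of `riemannZeta`. -/
noncomputable def zetaAlgebra : Subalgebra ℚ ℝ :=
  (MvPolynomial.aeval (R := ℚ)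
    (fun i : {i : ℕ // 2 ≤ i} => riemannZeta ((i : ℕ) : ℂ))).range.comap
      (Complex.ofRealAm.restrictScalars ℚ)

theorem isRatPolyInZetas_iff {x : ℝ} : IsRatPolyInZetas x ↔ x ∈ zetaAlgebra := by
  simp only [IsRatPolyInZetas, zetaAlgebra, Subalgebra.mem_comap, AlgHom.mem_range]
  exact exists_congr fun p => eq_comm

theorem tsum_zeta_mem {i : ℕ} (hi : 2 ≤ i) :
    ∑' n : ℕ, 1 / ((n : ℝ) + 1) ^ i ∈ zetaAlgebra := by
  rw [← isRatPolyInZetas_iff]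
  refine ⟨MvPolynomial.X ⟨i, hi⟩, ?_⟩
  rw [MvPolynomial.aeval_X, zeta_nat_eq_tsum_of_gt_one (by omega : 1 < i), Complex.ofReal_tsum]
  have h : Summable fun n : ℕ => 1 / (n : ℂ) ^ i := by
    simpa using Complex.summable_ofReal.2
      (Real.summable_one_div_nat_pow.2 (by omega : 1 < i))
  rw [h.tsum_eq_zero_add]
  simp [show i ≠ 0 by omega]

/-- The sequences that are summable with sum in the algebra of zeta values. -/
def zetaSummable : Submodule ℚ (ℕ → ℝ) where
  carrier := {f | ∃ x ∈ zetaAlgebra, HasSum f x}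
  zero_mem' := ⟨0, zero_mem _, hasSum_zero⟩
  add_mem' := fun ⟨x, hx, hf⟩ ⟨y, hy, hg⟩ => ⟨x + y, add_mem hx hy, hf.add hg⟩
  smul_mem' := fun q _ ⟨x, hx, hf⟩ => ⟨q • x, zetaAlgebra.smul_mem hx q, hf.const_smul q⟩

theorem zeta_mem_zetaSummable {i : ℕ} (hi : 2 ≤ i) :
    (fun n : ℕ => 1 / ((n : ℝ) + 1) ^ i) ∈ zetaSummable :=
  ⟨_, tsum_zeta_mem hi, (summable_zeta hi).hasSum⟩

theorem connSum_two_mem (l : ℕ) : connSum 2 l 0 ∈ zetaAlgebra := by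
  have h := (hasSum_connSum_two l).unique ((summable_zeta (i := l + 2) (by omega)).hasSum.mul_left _)
  rw [h]
  exact mul_mem (by exact_mod_cast natCast_mem zetaAlgebra (l + 1)) (tsum_zeta_mem (by omega))

theorem shiftedStar_div_sq_mem (l : ℕ) :
    (fun n : ℕ => shiftedStar l 0 (n + 1) / ((n : ℝ) + 1) ^ 2) ∈ zetaSummable :=
  ⟨_, connSum_two_mem l, by simpa using hasSum_connSum le_rfl l 0⟩

/-! ### Sums against differences of reciprocals -/

theorem antitone_recip (i : ℕ) : Antitone fun n : ℕ => 1 / ((n : ℝ) + 1 + i) :=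
  fun m n h => by
    dsimp only
    gcongr

theorem tendsto_shiftedStar_mul_recip (l i : ℕ) :
    Tendsto (fun n : ℕ => shiftedStar l 0 n * (1 / ((n : ℝ) + 1 + i))) atTop (𝓝 0) := by
  refine squeeze_zero (fun n => mul_nonneg (shiftedStar_nonneg _ _ _) (by positivity))
    (fun n => ?_) (tendsto_shiftedStar_div_atTop l)
  rw [div_eq_mul_one_div (shiftedStar l 0 n)]
  exact mul_le_mul_of_nonneg_left (one_div_le_one_div_of_le (by positivity) (by simp))
    (shiftedStar_nonneg _ _ _)

/-- Summation by parts lowers the depth `l + 1` to `l`. -/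
theorem hasSum_shiftedStar_succ_mul_sub (l i : ℕ) {x : ℝ}
    (h : HasSum (fun n : ℕ => shiftedStar l 0 (n + 1) / ((n : ℝ) + 1) * (1 / ((n : ℝ) + 1 + i))) x) :
    HasSum (fun n : ℕ => shiftedStar (l + 1) 0 (n + 1) *
      (1 / ((n : ℝ) + 1 + i) - 1 / ((n : ℝ) + 1 + (i + 1 : ℕ)))) x := by
  have key := (hasSum_abel_iff (A := shiftedStar (l + 1) 0)
    (x := x) (monotone_shiftedStar _ _) (shiftedStar_nonneg _ _ _) (antitone_recip i)
    (fun n => by positivity) (tendsto_shiftedStar_mul_recip _ _)).1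
    (hasSum_of_eq (fun n => by rw [shiftedStar_succ_succ]; simp) h)
  simp only [shiftedStar_succ_zero, zero_mul, add_zero] at key
  refine hasSum_of_eq (fun n => ?_) key
  push_cast
  ring_nf

theorem hasSum_one_div_sub_one_div (i : ℕ) :
    HasSum (fun n : ℕ => 1 / ((n : ℝ) + 1 + i) - 1 / ((n : ℝ) + 1 + (i + 1 : ℕ)))
      (1 / ((i : ℝ) + 1)) := by
  have key := (hasSum_abel_iff (A := shiftedStar 0 0)
    (x := 0) (monotone_shiftedStar _ _) (shiftedStar_nonneg _ _ _) (antitone_recip i)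
    (fun n => by positivity) (tendsto_shiftedStar_mul_recip _ _)).1 (by simp)
  rw [show 1 / ((i : ℝ) + 1) = 0 + shiftedStar 0 0 0 * (1 / (((0 : ℕ) : ℝ) + 1 + i)) by
    simp [add_comm]]
  refine hasSum_of_eq (fun n => ?_) key
  simp only [shiftedStar_zero_left]
  push_cast
  ring_nf

theorem sum_recip_sub (j : ℕ) (x : ℝ) :
    ∑ i ∈ range j, (1 / (x + (i : ℕ)) - 1 / (x + (i + 1 : ℕ))) = 1 / x - 1 / (x + j) := by
  simpa using sum_range_sub' (fun i : ℕ => 1 / (x + i)) j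

/-- Splitting `1 / m - 1 / (m + j)` into unit steps and summing by parts lowers the depth by one. The
step starting at `m` gives `ζ*(2, {1}_l)`; the one starting at `m + i`, `i ≥ 1`, gives a series of the
same shape, since `1 / (m (m + i)) = (1 / m - 1 / (m + i)) / i`. -/
theorem shiftedStar_mul_recip_sub_mem (l j : ℕ) :
    (fun n : ℕ => shiftedStar l 0 (n + 1) * (1 / ((n : ℝ) + 1) - 1 / ((n : ℝ) + 1 + j)))
      ∈ zetaSummable := by
  have split : ∀ l j : ℕ, (fun n : ℕ =>
      shiftedStar l 0 (n + 1) * (1 / ((n : ℝ) + 1) - 1 / ((n : ℝ) + 1 + j)))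
      = ∑ i ∈ range j, fun n : ℕ => shiftedStar l 0 (n + 1) *
        (1 / ((n : ℝ) + 1 + i) - 1 / ((n : ℝ) + 1 + (i + 1 : ℕ))) := fun l j => by
    funext n
    rw [Finset.sum_apply, ← mul_sum, sum_recip_sub]
  induction l generalizing j with
  | zero =>
    rw [split]
    refine sum_mem fun i _ => ⟨1 / ((i : ℝ) + 1), ?_, ?_⟩
    · simpa using zetaAlgebra.algebraMap_mem (1 / ((i : ℚ) + 1))
    · simpa using hasSum_one_div_sub_one_div i
  | succ l ih =>
    rw [split]
    refine sum_mem fun i _ => ?_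
    suffices h : (fun n : ℕ => shiftedStar l 0 (n + 1) / ((n : ℝ) + 1) *
        (1 / ((n : ℝ) + 1 + i))) ∈ zetaSummable by
      obtain ⟨x, hx, h⟩ := h
      exact ⟨x, hx, hasSum_shiftedStar_succ_mul_sub l i h⟩
    obtain rfl | hi := Nat.eq_zero_or_pos i
    · convert shiftedStar_div_sq_mem l using 2 with n
      push_cast
      rw [add_zero]
      field_simp
    · convert zetaSummable.smul_mem (1 / (i : ℚ)) (ih i) using 1
      funext n
      have : (0 : ℝ) < i := by exact_mod_cast hi
      rw [Pi.smul_apply, Rat.smul_def]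
      push_cast
      field_simp
      ring

/-- The variant with the star value truncated at `m - 1`, obtained from the one truncated at `m` by
removing the terms with `n₁ = m`. -/
theorem shiftedStar_pred_mul_recip_sub_mem (l j : ℕ) :
    (fun n : ℕ => shiftedStar l 0 n * (1 / ((n : ℝ) + 1) - 1 / ((n : ℝ) + 1 + j)))
      ∈ zetaSummable := by
  cases l with
  | zero => exact shiftedStar_mul_recip_sub_mem 0 j
  | succ l =>
    obtain rfl | hj := Nat.eq_zero_or_pos j
    · convert zetaSummable.zero_mem using 1
      funext n
      simp
    convert sub_mem (shiftedStar_mul_recip_sub_mem (l + 1) j)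
      (sub_mem (shiftedStar_div_sq_mem l)
        (zetaSummable.smul_mem (1 / (j : ℚ)) (shiftedStar_mul_recip_sub_mem l j))) using 1
    funext n
    have : (0 : ℝ) < j := by exact_mod_cast hj
    simp only [Pi.sub_apply, Pi.smul_apply, Rat.smul_def]
    rw [shiftedStar_succ_succ]
    push_cast
    field_simp
    ring

/-! ### Reciprocal binomial coefficients -/

/-- The sequence `1 / (m * C(m + r, r))` at `m = n + 1`. -/
noncomputable def recipChoose (r n : ℕ) : ℝ :=
  1 / (((n + 1 + r).choose r : ℝ) * ((n : ℝ) + 1))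

/-- The reciprocals `1 / (m C(m + r, r)) = r! / (m (m + 1) ⋯ (m + r))` are iterated differences of
`1 / m`. -/
theorem recipChoose_succ (r n : ℕ) :
    recipChoose (r + 1) n = recipChoose r n - recipChoose r (n + 1) := by
  have h1 := choose_succ_left (n + 1) r
  have h2 := choose_succ_right (n + 1) r
  have p1 := choose_pos_real (n + 1) r
  have h1' : ((n + 1 + 1 + r).choose r : ℝ) = ((n + 1 + r).choose r : ℝ) * (n + 1 + r + 1) / (n + 2) := by
    push_cast at h1
    field_simp
    linear_combination h1
  have h2' : ((n + 1 + (r + 1)).choose (r + 1) : ℝ)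
      = ((n + 1 + r).choose r : ℝ) * (n + 1 + r + 1) / (r + 1) := by
    push_cast at h2
    field_simp
    linear_combination h2
  simp only [recipChoose]
  rw [h1', h2']
  push_cast
  field_simp
  ring

/-- The rational span of the sequences `1 / m - 1 / (m + j)` at `m = n + 1`. -/
noncomputable def recipSpan : Submodule ℚ (ℕ → ℝ) :=
  Submodule.span ℚ (Set.range fun j n : ℕ => 1 / ((n : ℝ) + 1) - 1 / ((n : ℝ) + 1 + j))

theorem recipSpan_shift {f : ℕ → ℝ} (hf : f ∈ recipSpan) :
    (fun n => f (n + 1)) ∈ recipSpan := by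
  have h := Submodule.mem_map_of_mem (f := LinearMap.funLeft ℚ ℝ Nat.succ) hf
  rw [recipSpan, Submodule.map_span] at h
  refine Submodule.span_le.2 ?_ h
  rintro _ ⟨_, ⟨j, rfl⟩, rfl⟩
  have h1 : ∀ j : ℕ, (fun n : ℕ => 1 / ((n : ℝ) + 1) - 1 / ((n : ℝ) + 1 + j)) ∈ recipSpan :=
    fun j => Submodule.subset_span ⟨j, rfl⟩
  rw [SetLike.mem_coe]
  convert sub_mem (h1 (j + 1)) (h1 1) using 1
  funext n
  simp only [LinearMap.funLeft_apply, Pi.sub_apply]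
  push_cast
  ring_nf

theorem recipChoose_succ_mem_recipSpan (r : ℕ) : recipChoose (r + 1) ∈ recipSpan := by
  induction r with
  | zero =>
    refine Submodule.subset_span ⟨1, ?_⟩
    funext n
    rw [recipChoose_succ]
    simp [recipChoose]
  | succ r ih =>
    convert sub_mem ih (recipSpan_shift ih) using 1
    funext n
    exact recipChoose_succ _ _

theorem shiftedStar_mul_recipChoose_mem (l r : ℕ) :
    (fun n => shiftedStar l 0 n * recipChoose (r + 1) n) ∈ zetaSummable := by
  have h := Submodule.mem_map_of_mem (f := LinearMap.mulLeft ℚ (shiftedStar l 0))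
    (recipChoose_succ_mem_recipSpan r)
  rw [recipSpan, Submodule.map_span] at h
  refine Submodule.span_le.2 ?_ h
  rintro _ ⟨_, ⟨j, rfl⟩, rfl⟩
  exact shiftedStar_pred_mul_recip_sub_mem l j

theorem recipChoose_div_sub (r n : ℕ) :
    recipChoose r n / ((n : ℝ) + 1) - recipChoose (r + 1) n / ((n : ℝ) + 1)
      = recipChoose (r + 1) n / ((r : ℝ) + 1) := by
  have h2 := choose_succ_right (n + 1) r
  have p1 := choose_pos_real (n + 1) r
  have h2' : ((n + 1 + (r + 1)).choose (r + 1) : ℝ)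
      = ((n + 1 + r).choose r : ℝ) * (n + 1 + r + 1) / (r + 1) := by
    push_cast at h2
    field_simp
    linear_combination h2
  simp only [recipChoose]
  rw [h2']
  field_simp
  ring

/-- The relation `recipChoose_div_sub` lowers `r` at the cost of series with a simple factor `1 / m`,
so only the case `r = 0` has to be assumed. -/
theorem shiftedStar_mul_recipChoose_div_mem {l : ℕ}
    (h : (fun n : ℕ => shiftedStar l 0 n / ((n : ℝ) + 1) ^ 2) ∈ zetaSummable) (r : ℕ) :
    (fun n : ℕ => shiftedStar l 0 n * (recipChoose r n / ((n : ℝ) + 1))) ∈ zetaSummable := by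
  induction r with
  | zero =>
    convert h using 2 with n
    simp [recipChoose]
    field_simp
  | succ r ih =>
    convert sub_mem ih (zetaSummable.smul_mem (1 / ((r : ℚ) + 1))
      (shiftedStar_mul_recipChoose_mem l r)) using 1
    funext n
    have := recipChoose_div_sub r n
    simp only [Pi.sub_apply, Pi.smul_apply, Rat.smul_def]
    push_cast
    linear_combination -(shiftedStar l 0 n) * this

/-! ### The Euler sum of weight four -/

/-- The square of a partial sum of `ζ(2)` splits into its diagonal and off-diagonal parts. -/
theorem sq_sum_range (f : ℕ → ℝ) (N : ℕ) :
    2 * ∑ n ∈ range N, f n * ∑ m ∈ range (n + 1), f m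
      = (∑ n ∈ range N, f n) ^ 2 + ∑ n ∈ range N, f n ^ 2 := by
  induction N with
  | zero => simp
  | succ N ih =>
    rw [sum_range_succ, mul_add, ih, sum_range_succ f, sum_range_succ (fun n => f n ^ 2)]
    ring

theorem connSum_two_zero_succ (k : ℕ) :
    connSum 2 0 (k + 1) = connSum 2 0 0 - ∑ m ∈ range (k + 1), 1 / ((m : ℝ) + 1) ^ 2 := by
  have := sum_range_sub' (connSum 2 0) (k + 1)
  simp only [connSum_two_sub] at this
  simp only [Nat.cast_zero, zero_add] at this
  linarith

/-- The series `∑_k (1/k²) ∑_{j > k} 1/j² = ζ(2, 2)` has the value `(ζ(2)² - ζ(4)) / 2`, written below as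
`ζ(2)² - (ζ(2)² + ζ(4)) / 2`. -/
theorem connSum_two_zero_mem :
    (fun k : ℕ => connSum 2 0 (k + 1) / ((k : ℝ) + 1) ^ 2) ∈ zetaSummable := by
  set z := connSum 2 0 0
  set w := ∑' n : ℕ, 1 / ((n : ℝ) + 1) ^ 4
  have hz := connSum_two_mem 0
  have hw := tsum_zeta_mem (i := 4) (by norm_num)
  refine ⟨z * z - (1 / 2 : ℚ) • (z * z + w), sub_mem (mul_mem hz hz)
    (zetaAlgebra.smul_mem (add_mem (mul_mem hz hz) hw) _), ?_⟩
  have hz2 : HasSum (fun n : ℕ => 1 / ((n : ℝ) + 1) ^ 2) z := by simpa using hasSum_connSum_two 0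
  have hw4 : HasSum (fun n : ℕ => (1 / ((n : ℝ) + 1) ^ 2) ^ 2) w := by
    refine hasSum_of_eq (fun n => ?_) (summable_zeta (i := 4) (by norm_num)).hasSum
    rw [div_pow, one_pow, ← pow_mul]
  rw [hasSum_iff_tendsto_nat_of_nonneg fun k => div_nonneg (connSum_nonneg _ _ _) (by positivity)]
  have e : ∀ N, ∑ k ∈ range N, connSum 2 0 (k + 1) / ((k : ℝ) + 1) ^ 2
      = z * ∑ k ∈ range N, 1 / ((k : ℝ) + 1) ^ 2
        - (1 / 2) * ((∑ n ∈ range N, 1 / ((n : ℝ) + 1) ^ 2) ^ 2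
          + ∑ n ∈ range N, (1 / ((n : ℝ) + 1) ^ 2) ^ 2) := fun N => by
    rw [← sq_sum_range, mul_sum, ← mul_assoc, one_div_mul_cancel two_ne_zero, one_mul,
      ← sum_sub_distrib]
    refine sum_congr rfl fun k _ => ?_
    rw [connSum_two_zero_succ]
    ring
  simp only [e]
  have t2 := hz2.tendsto_sum_nat
  have := (t2.const_mul z).sub (((t2.pow 2).add hw4.tendsto_sum_nat).const_mul (1 / 2))
  rw [Rat.smul_def]
  convert this using 2
  push_cast
  ring

/-- The Euler sum `∑ₙ Hₙ / n³`. Expanding it by connected sums gives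
`∑ₙ Hₙ / n³ = ζ(2, 2) + 2 ζ(3, 1)`, where `ζ(3, 1) = ∑ₙ Hₙ / n³ - ζ(4)`; this is solved for the
sum. -/
theorem connSum_three_mem : connSum 3 1 0 ∈ zetaAlgebra := by
  obtain ⟨y, hy, hY⟩ := connSum_two_zero_mem
  set T := connSum 3 1 0
  have hw := tsum_zeta_mem (i := 4) (by norm_num)
  set w := ∑' n : ℕ, 1 / ((n : ℝ) + 1) ^ 4
  have hw4 : HasSum (fun n : ℕ => 1 / ((n : ℝ) + 1) ^ 4) w :=
    (summable_zeta (i := 4) (by norm_num)).hasSum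
  have hT : HasSum (fun n : ℕ => shiftedStar 1 0 (n + 1) / ((n : ℝ) + 1) ^ 3) T := by
    simpa using hasSum_connSum (p := 3) (by norm_num) 1 0
  -- `∑ H_{n-1} / n³ = T - ζ(4)`, by removing the diagonal
  have h31 : HasSum (fun n : ℕ => shiftedStar 1 0 n * (2 * (1 / ((n : ℝ) + 1) ^ 3)))
      (2 * (T - w)) := by
    refine hasSum_of_eq (fun n => ?_) ((hT.sub hw4).mul_left 2)
    rw [shiftedStar_succ_succ]
    simp
    field_simp
    ring
  have h31' : HasSum (fun n : ℕ => shiftedStar 1 0 (n + 1) *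
      (connSum 2 1 (n + 1) - connSum 2 1 (n + 2))) (2 * (T - w)) := by
    rw [← hasSum_nat_add_iff' 1] at h31
    simp only [range_one, sum_singleton, shiftedStar_succ_zero, zero_mul, sub_zero] at h31
    refine hasSum_of_eq (fun n => ?_) h31
    rw [connSum_two_sub]
    push_cast
    ring
  have e : ∀ k, connSum 3 1 k - connSum 3 1 (k + 1)
      = connSum 2 0 (k + 1) / ((k : ℝ) + 1) ^ 2 + connSum 2 1 (k + 1) / ((k : ℝ) + 1) := fun k => by
    have h1 := connSum_succ_sub (p := 2) (by norm_num) 0 k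
    have h0 := connSum_zero_sub (p := 2) (by norm_num) k
    have hk : (k : ℝ) + 1 ≠ 0 := by positivity
    norm_num at h1 h0
    field_simp
    linear_combination ((k : ℝ) + 1) * h1 + h0
  -- summation by parts turns `∑ (1/k) ∑_{j > k} 2/j³` into `2 ∑ H_{j-1} / j³`
  have hB : HasSum (fun k : ℕ => connSum 2 1 (k + 1) / ((k : ℝ) + 1)) (2 * (T - w)) := by
    have hanti : Antitone fun n => connSum 2 1 (n + 1) := antitone_nat_of_succ_le fun n => by
      have h := connSum_two_sub 1 (n + 1)
      have : (0 : ℝ) ≤ ((1 : ℕ) + 1) / (((n + 1 : ℕ) : ℝ) + 1) ^ (1 + 2) := by positivity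
      linarith
    have hlim : Tendsto (fun n => shiftedStar 1 0 n * connSum 2 1 (n + 1)) atTop (𝓝 0) := by
      refine squeeze_zero (fun n => mul_nonneg (shiftedStar_nonneg _ _ _) (connSum_nonneg _ _ _))
        (fun n => ?_) (by simpa using (tendsto_shiftedStar_div_atTop 1).mul_const (connSum 2 1 0))
      rw [div_mul_eq_mul_div, mul_div_assoc]
      refine mul_le_mul_of_nonneg_left ((connSum_le le_rfl 1 (n + 1)).trans ?_)
        (shiftedStar_nonneg _ _ _)
      refine div_le_div_of_nonneg_left (connSum_nonneg _ _ _) (by positivity) ?_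
      push_cast
      linarith
    refine hasSum_of_eq (fun n => ?_) ((hasSum_abel_iff (A := shiftedStar 1 0)
      (monotone_shiftedStar _ _) (shiftedStar_nonneg _ _ _) hanti
      (fun n => connSum_nonneg _ _ _) hlim).2 (by simpa using h31'))
    rw [shiftedStar_succ_succ]
    simp
    field_simp
  have hsum := hY.add hB
  have htel := hasSum_telescope (f := connSum 3 1) (by simpa only [e] using hsum.summable)
    (tendsto_connSum (by norm_num) 1)
  simp only [e] at htel
  have : T = y + 2 * (T - w) := htel.unique hsum
  have hTw : T = w + w - y := by linarith
  rw [hTw]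
  exact sub_mem (add_mem hw hw) hy

theorem shiftedStar_pred_div_sq_mem {l : ℕ} (hl : l ≤ 2) :
    (fun n : ℕ => shiftedStar l 0 n / ((n : ℝ) + 1) ^ 2) ∈ zetaSummable := by
  interval_cases l
  · simpa using shiftedStar_div_sq_mem 0
  · convert sub_mem (shiftedStar_div_sq_mem 1) (zeta_mem_zetaSummable (i := 3) (by norm_num)) using 1
    funext n
    simp only [Pi.sub_apply, shiftedStar_succ_succ]
    simp
    field_simp
    ring
  · have h3 : (fun n : ℕ => shiftedStar 1 0 (n + 1) / ((n : ℝ) + 1) ^ 3) ∈ zetaSummable :=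
      ⟨_, connSum_three_mem, by simpa using hasSum_connSum (p := 3) (by norm_num) 1 0⟩
    convert sub_mem (shiftedStar_div_sq_mem 2) h3 using 1
    funext n
    simp only [Pi.sub_apply]
    rw [shiftedStar_succ_succ 1]
    push_cast
    field_simp
    ring

/-! ### The summands of the series -/

theorem seriesTerm_one_eq (l r : ℕ) :
    (fun n => seriesTerm l 0 r 1 (n + 1)) = fun n => shiftedStar l 0 n * recipChoose r n := by
  funext n
  simp [seriesTerm, truncMZSV_eq_shiftedStar, truncMZV, recipChoose, div_eq_mul_inv]

theorem seriesTerm_two_eq (l r : ℕ) :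
    (fun n => seriesTerm l 0 r 2 (n + 1))
      = fun n : ℕ => shiftedStar l 0 n * (recipChoose r n / ((n : ℝ) + 1)) := by
  funext n
  simp only [seriesTerm, truncMZSV_eq_shiftedStar, truncMZV, recipChoose, List.replicate_zero]
  push_cast
  simp
  field_simp

theorem summable_and_isRatPolyInZetas {f : ℕ → ℝ} (hf : f ∈ zetaSummable) :
    Summable f ∧ IsRatPolyInZetas (∑' n, f n) := by
  obtain ⟨x, hx, h⟩ := hf
  exact ⟨h.summable, isRatPolyInZetas_iff.2 (h.tsum_eq ▸ hx)⟩

end ZetaStar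

open ZetaStar in
theorem mainTheorem6 :
    (∀ l₁ r₁ : ℕ, 1 ≤ r₁ →
      Summable (fun n : ℕ => seriesTerm l₁ 0 r₁ 1 (n + 1)) ∧
        IsRatPolyInZetas (seriesS l₁ 0 r₁ 1)) ∧
    (∀ l₁ r₁ : ℕ, l₁ ≤ 2 →
      Summable (fun n : ℕ => seriesTerm l₁ 0 r₁ 2 (n + 1)) ∧
        IsRatPolyInZetas (seriesS l₁ 0 r₁ 2)) := by
  refine ⟨fun l r hr => summable_and_isRatPolyInZetas ?_,
    fun l r hl => summable_and_isRatPolyInZetas ?_⟩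
  · obtain ⟨r, rfl⟩ := Nat.exists_eq_add_of_le' hr
    rw [seriesTerm_one_eq]
    exact shiftedStar_mul_recipChoose_mem l r
  · rw [seriesTerm_two_eq]
    exact shiftedStar_mul_recipChoose_div_mem (shiftedStar_pred_div_sq_mem hl) r
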